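/- Let $d \ge 0$ be an integer, let $f\in\mathbb{C}[x_1,\ldots,x_d]$, and let $r_1,\ldots,r_d\in\mathbb{C}(x)$ be nonzero univariate rational functions such that $$\frac{\partial f/\partial x_1}{r_1(x_1)}=\cdots=\frac{\partial f/\partial x_d}{r_d(x_d)}$$ in the field of rational functions $\mathbb{C}(x_1,\ldots,x_d)$. Then $f$ is of one of the forms $$f(x_1,\ldots,x_d)=h\bigl(p_1(x_1)+\cdots+p_d(x_d)\bigr)\quad\text{or}\quad f(x_1,\ldots,x_d)=h\bigl(p_1(x_1)\cdot\ldots\cdot p_d(x_d)\bigr)$$ for some univariate polynomials $h,p_1,\ldots,p_d\in\mathbb{C}[x]$. Moreover, if $f$ has real coefficients, then $h,p_1,\ldots,p_d$ can be taken to be real univariate polynomials: if $f$ is of the first (respectively second) form with complex $h,p_1,\ldots,p_d$, then it is of the first (respectively second) form with $h,p_1,\ldots,p_d\in\mathbb{R}[x]$. -/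

import Mathlib

open scoped Polynomial

/-- `r(x_i)`: the univariate rational function `r`, evaluated at the `i`-th variable, as an element
of the field of rational functions in `x_1, …, x_d`. (The denominator of `r` is a nonzero polynomial
and `x_i` is transcendental over `K`, so no division by zero is involved.) -/
noncomputable def ratFuncInVar {K : Type*} [Field K] {d : ℕ} (i : Fin d) (r : RatFunc K) :
    FractionRing (MvPolynomial (Fin d) K) :=
  RatFunc.eval (algebraMap K (FractionRing (MvPolynomial (Fin d) K)))
    (algebraMap (MvPolynomial (Fin d) K) (FractionRing (MvPolynomial (Fin d) K))
      (MvPolynomial.X i)) r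

/-- `f(x_1, …, x_d) = h(p_1(x_1) + ⋯ + p_d(x_d))` for univariate polynomials `h, p_1, …, p_d`
over `K`. -/
def HasAdditiveForm {K : Type*} [Field K] {d : ℕ} (f : MvPolynomial (Fin d) K) : Prop :=
  ∃ (h : K[X]) (p : Fin d → K[X]),
    f = Polynomial.aeval (∑ i, Polynomial.aeval (MvPolynomial.X i : MvPolynomial (Fin d) K) (p i)) h

/-- `f(x_1, …, x_d) = h(p_1(x_1) ⋯ p_d(x_d))` for univariate polynomials `h, p_1, …, p_d`
over `K`. -/
def HasMultiplicativeForm {K : Type*} [Field K] {d : ℕ} (f : MvPolynomial (Fin d) K) : Prop :=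
  ∃ (h : K[X]) (p : Fin d → K[X]),
    f = Polynomial.aeval (∏ i, Polynomial.aeval (MvPolynomial.X i : MvPolynomial (Fin d) K) (p i)) h

/-! Write `r i = a i / b i` in lowest terms and let E f be the common value of (b_i/a_i) ∂_i f;
`EulerRel a b f g` says E f = g. E is a derivation on the algebra of those f for which all these
quotients agree. With at least two variables, commuting partials and coprimality make E preserve
this algebra (`exists_next`). The relation in x_j shows that E does not raise the degree in x_i, and
comparing top coefficients in the relation in x_i shows that E - k(n+1) lowers degree n+1, for one
constant k (`natDegree_slice_sub_le`).

If k = 0, E is locally nilpotent: some s has E s = 1, such an s is a sum of univariate polynomials,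
and repeated integration makes f a polynomial in s. If k ≠ 0, f is a sum of eigenvectors with
eigenvalues km. Eigenspaces are lines, so eigenvectors are products of univariate polynomials, and
all of them are multiples of powers of one with least positive m; so f is a polynomial in that
product.

For real f, comparing ∂_k f with its complex conjugate shows that the p_k' (additive case) or the
p_k (multiplicative case) are real up to constant factors. These are absorbed into h, whose real
part then suffices. -/

namespace MvPolynomial

/-- The univariate polynomial `p` evaluated at the `i`-th variable. -/
noncomputable abbrev inVar {K σ : Type*} [CommSemiring K] (i : σ) (p : K[X]) : MvPolynomial σ K :=
  Polynomial.aeval (X i : MvPolynomial σ K) p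

/-- Specialise every variable except the `i`-th one to the values `c`, and regard the result as a
univariate polynomial in the `i`-th variable. -/
noncomputable def slice {K S σ : Type*} [CommSemiring K] [CommSemiring S] [Algebra K S]
    [DecidableEq σ] (i : σ) (c : σ → S) : MvPolynomial σ K →ₐ[K] S[X] :=
  aeval fun j => if j = i then Polynomial.X else Polynomial.C (c j)

/-! ### Partial derivatives of polynomials in one variable -/

section InVar

variable {K σ : Type*} [CommRing K]

theorem inVar_zero (i : σ) : inVar i (0 : K[X]) = 0 := map_zero _

theorem inVar_mul (i : σ) (p q : K[X]) : inVar i (p * q) = inVar i p * inVar i q := map_mul _ _ _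

theorem inVar_C (i : σ) (c : K) : inVar i (Polynomial.C c) = C c := Polynomial.aeval_C _ _

theorem pderiv_pderiv_comm (i j : σ) (f : MvPolynomial σ K) :
    pderiv j (pderiv i f) = pderiv i (pderiv j f) := by
  by_cases hij : i = j
  · rw [hij]
  ext m
  simp only [coeff_pderiv, add_assoc, add_comm (Finsupp.single j 1)]
  simp [hij, Ne.symm hij]
  ring

theorem pderiv_inVar_self (i : σ) (p : K[X]) :
    pderiv i (inVar i p) = inVar i (Polynomial.derivative p) := by
  rw [inVar, Derivation.map_aeval, pderiv_X_self, smul_eq_mul, mul_one]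

theorem pderiv_inVar_of_ne {i j : σ} (h : j ≠ i) (p : K[X]) : pderiv i (inVar j p) = 0 := by
  rw [inVar, Derivation.map_aeval, pderiv_X_of_ne h, smul_zero]

end InVar

/-! ### Restriction to a line and degree in one variable -/

section Slice

variable {K S σ : Type*} [CommRing K] [CommRing S] [Algebra K S] [DecidableEq σ]

theorem slice_X_self (i : σ) (c : σ → S) :
    slice i c (X i : MvPolynomial σ K) = Polynomial.X := by
  simp [slice]

theorem slice_X_of_ne {i j : σ} (h : j ≠ i) (c : σ → S) :
    slice i c (X j : MvPolynomial σ K) = Polynomial.C (c j) := by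
  simp [slice, h]

theorem slice_C (i : σ) (c : σ → S) (k : K) :
    slice i c (C k) = Polynomial.C (algebraMap K S k) := by
  rw [← algebraMap_eq, AlgHom.commutes, Polynomial.algebraMap_apply]

theorem slice_inVar_self (i : σ) (c : σ → S) (p : K[X]) :
    slice i c (inVar i p) = p.map (algebraMap K S) := by
  rw [← Polynomial.aeval_algHom_apply, slice_X_self, Polynomial.aeval_X_left_eq_map]

theorem slice_inVar_of_ne {i j : σ} (h : j ≠ i) (c : σ → S) (p : K[X]) :
    slice i c (inVar j p) = Polynomial.C (Polynomial.aeval (c j) p) := by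
  rw [← Polynomial.aeval_algHom_apply, slice_X_of_ne h]
  exact (Polynomial.aeval_algHom_apply (Polynomial.CAlgHom (R := K) (A := S)) (c j) p)

theorem derivative_slice (i : σ) (c : σ → S) (f : MvPolynomial σ K) :
    Polynomial.derivative (slice i c f) = slice i c (pderiv i f) := by
  induction f using MvPolynomial.induction_on with
  | C a =>
    rw [pderiv_C, map_zero, slice_C, Polynomial.derivative_C]
  | add p q hp hq => simp [hp, hq]
  | mul_X p j hp =>
    by_cases h : j = i
    · subst h
      simp [slice_X_self, hp]
      ring
    · simp [slice_X_of_ne h, pderiv_X_of_ne h, hp]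
      ring

theorem eval_slice (i : σ) (c : σ → S) (t : S) (f : MvPolynomial σ K) :
    (slice i c f).eval t = aeval (Function.update c i t) f := by
  induction f using MvPolynomial.induction_on with
  | C a =>
    rw [slice_C, Polynomial.eval_C, aeval_C]
  | add p q hp hq => simp [hp, hq]
  | mul_X p j hp =>
    by_cases h : j = i
    · subst h
      simp [slice_X_self, hp]
    · simp [slice_X_of_ne h, hp, Function.update_of_ne h]

/-- Substituting `X i` back for the new variable recovers the polynomial. Hence `natDegree` of this
slice can serve as the degree in x_i. -/
theorem slice_X_injective (i : σ) :
    Function.Injective (slice i (X : σ → MvPolynomial σ K) : MvPolynomial σ K →ₐ[K] _) := by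
  intro f g h
  have := congrArg (Polynomial.eval (X i)) h
  simpa [eval_slice, aeval_X_left] using this

theorem coeff_slice_pderiv {i j : σ} (h : j ≠ i) (f : MvPolynomial σ K) (n : ℕ) :
    (slice i (X : σ → MvPolynomial σ K) (pderiv j f)).coeff n =
      pderiv j ((slice i (X : σ → MvPolynomial σ K) f).coeff n) := by
  induction f using MvPolynomial.induction_on generalizing n with
  | C a =>
    rw [pderiv_C, map_zero, slice_C, Polynomial.coeff_C, algebraMap_eq]
    split_ifs <;> simp
  | add p q hp hq => simp [hp, hq]
  | mul_X p k hp =>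
    by_cases hk : k = i
    · subst hk
      cases n <;> simp [slice_X_self, hp, pderiv_X_of_ne h.symm]
    · by_cases hkj : k = j
      · subst hkj
        simp [slice_X_of_ne hk, hp]
      · simp [slice_X_of_ne hk, hp, pderiv_X_of_ne hkj]

theorem natDegree_slice_pderiv_le {i j : σ} (h : j ≠ i) (f : MvPolynomial σ K) :
    (slice i (X : σ → MvPolynomial σ K) (pderiv j f)).natDegree ≤
      (slice i (X : σ → MvPolynomial σ K) f).natDegree := by
  rw [Polynomial.natDegree_le_iff_coeff_eq_zero]
  intro n hn
  rw [coeff_slice_pderiv h, Polynomial.coeff_eq_zero_of_natDegree_lt hn, map_zero]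

theorem pderiv_sum_inVar [Fintype σ] (p : σ → K[X]) (i : σ) :
    pderiv i (∑ j, inVar j (p j)) = inVar i (Polynomial.derivative (p i)) := by
  rw [map_sum, Finset.sum_eq_single i, pderiv_inVar_self]
  · exact fun j _ hj => pderiv_inVar_of_ne hj _
  · simp

theorem pderiv_prod_inVar [Fintype σ] (p : σ → K[X]) (i : σ) :
    pderiv i (∏ j, inVar j (p j)) =
      inVar i (Polynomial.derivative (p i)) * ∏ j ∈ Finset.univ.erase i, inVar j (p j) := by
  have h : pderiv i (∏ j ∈ Finset.univ.erase i, inVar j (p j)) = 0 := by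
    apply Finset.prod_induction (fun j => inVar j (p j)) (fun q => pderiv i q = 0)
    · intro a b ha hb
      simp [ha, hb]
    · exact pderiv_one
    · intro j hj
      exact pderiv_inVar_of_ne (Finset.ne_of_mem_erase hj) _
  rw [← Finset.mul_prod_erase _ _ (Finset.mem_univ i), pderiv_mul, h, mul_zero, add_zero,
    pderiv_inVar_self]

end Slice

section Field

variable {K σ : Type*} [Field K]

theorem inVar_injective (i : σ) : Function.Injective (inVar i : K[X] → MvPolynomial σ K) := by
  classical
  intro p q h
  have := congrArg (slice i (fun _ => (0 : K))) h
  simpa only [slice_inVar_self, Algebra.algebraMap_self, Polynomial.map_id] using this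

theorem inVar_ne_zero (i : σ) {p : K[X]} (hp : p ≠ 0) : (inVar i p : MvPolynomial σ K) ≠ 0 :=
  fun h => hp (inVar_injective (σ := σ) i (by rw [h, inVar, map_zero]))

theorem pderiv_eq_zero_of_natDegree_slice [DecidableEq σ] {i : σ} {f : MvPolynomial σ K}
    (h : (slice i (X : σ → MvPolynomial σ K) f).natDegree = 0) : pderiv i f = 0 := by
  apply slice_X_injective i
  rw [map_zero, ← derivative_slice, Polynomial.eq_C_of_natDegree_eq_zero h,
    Polynomial.derivative_C]

theorem pderiv_eq_zero_of_dvd_inVar {i j : σ} (h : j ≠ i) {p : K[X]} (hp : p ≠ 0)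
    {q : MvPolynomial σ K} (hq : q ∣ inVar j p) : pderiv i q = 0 := by
  classical
  apply pderiv_eq_zero_of_natDegree_slice
  have h1 := map_dvd (slice i (X : σ → MvPolynomial σ K)) hq
  have h2 : slice i (X : σ → MvPolynomial σ K) (inVar j p) ≠ 0 := fun h0 =>
    inVar_ne_zero j hp (slice_X_injective i (h0.trans (map_zero _).symm))
  have h3 := Polynomial.natDegree_le_of_dvd h1 h2
  rw [slice_inVar_of_ne h, Polynomial.natDegree_C] at h3
  omega

end Field

/-! ### Constants, coprimality and vanishing Wronskians -/

section CharZero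

variable {K σ : Type*} [Field K] [CharZero K]

theorem eq_C_of_pderiv_eq_zero {f : MvPolynomial σ K} (h : ∀ i, pderiv i f = 0) :
    f = C (coeff 0 f) := by
  classical
  ext m
  rw [coeff_C]
  split_ifs with hm
  · rw [hm]
  obtain ⟨i, hi⟩ : ∃ i, m i ≠ 0 := by
    by_contra! hm'
    exact hm (Finsupp.ext fun i => (hm' i).symm)
  have hle : Finsupp.single i 1 ≤ m := by
    rw [Finsupp.single_le_iff]; omega
  have := coeff_pderiv (i := i) f (m - Finsupp.single i 1)
  rw [h i, coeff_zero, tsub_add_cancel_of_le hle] at this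
  simp only [Finsupp.coe_tsub, Pi.sub_apply, Finsupp.single_eq_same] at this
  rcases mul_eq_zero.mp this.symm with h0 | h0
  · exact h0
  · exact absurd h0 (Nat.cast_add_one_ne_zero _)

/-- A common divisor has degree 0 in every variable, since each variable is missing from one of the
two polynomials. -/
theorem isRelPrime_inVar {i j : σ} (h : i ≠ j) {p q : K[X]} (hp : p ≠ 0) (hq : q ≠ 0) :
    IsRelPrime (inVar i p : MvPolynomial σ K) (inVar j q) := by
  intro s hs ht
  have hs0 : s ≠ 0 := ne_zero_of_dvd_ne_zero (inVar_ne_zero i hp) hs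
  have hc := eq_C_of_pderiv_eq_zero (f := s) fun k => by
    by_cases hk : k = i
    · exact pderiv_eq_zero_of_dvd_inVar (by rw [hk]; exact h.symm) hq ht
    · exact pderiv_eq_zero_of_dvd_inVar (Ne.symm hk) hp hs
  rw [hc] at hs0 ⊢
  exact (IsUnit.mk0 _ fun h0 => hs0 (by rw [h0, C_0])).map C

/-- In lowest terms u'/v', the hypothesis forces v' to divide ∂_i v', which has smaller degree in
x_i; so v', and then u', is constant. -/
theorem exists_eq_C_mul_of_wronskian_eq_zero {u v : MvPolynomial σ K} (hv : v ≠ 0)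
    (h : ∀ i, v * pderiv i u = u * pderiv i v) : ∃ c : K, u = C c * v := by
  classical
  obtain ⟨u', v', g, hrel, rfl, rfl⟩ := UniqueFactorizationMonoid.exists_reduced_factors' u v hv
  have hg : g ≠ 0 := left_ne_zero_of_mul hv
  have hv' : v' ≠ 0 := right_ne_zero_of_mul hv
  have h' : ∀ i, v' * pderiv i u' = u' * pderiv i v' := by
    intro i
    have := h i
    simp only [pderiv_mul] at this
    apply mul_left_cancel₀ (mul_ne_zero hg hg)
    linear_combination this
  have hdv : ∀ i, pderiv i v' = 0 := by
    intro i
    apply pderiv_eq_zero_of_natDegree_slice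
    by_contra hn
    have hdvd : v' ∣ pderiv i v' := by
      apply hrel.symm.dvd_of_dvd_mul_left
      rw [← h' i]
      exact dvd_mul_right _ _
    have h1 := map_dvd (slice i (X : σ → MvPolynomial σ K)) hdvd
    rw [← derivative_slice] at h1
    by_cases h2 : Polynomial.derivative (slice i (X : σ → MvPolynomial σ K) v') = 0
    · exact hn (Polynomial.derivative_eq_zero.mp h2)
    · have h3 := Polynomial.natDegree_le_of_dvd h1 h2
      have h4 := Polynomial.natDegree_derivative_lt hn
      omega
  have hdu : ∀ i, pderiv i u' = 0 := by
    intro i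
    have := h' i
    rw [hdv i, mul_zero] at this
    exact (mul_eq_zero.mp this).resolve_left hv'
  rw [eq_C_of_pderiv_eq_zero hdu]
  have hvc := eq_C_of_pderiv_eq_zero hdv
  have hc0 : coeff 0 v' ≠ 0 := fun h0 => hv' (by rw [hvc, h0, C_0])
  refine ⟨coeff 0 u' / coeff 0 v', ?_⟩
  rw [hvc, coeff_C, if_pos rfl, mul_left_comm, ← C_mul, div_mul_cancel₀ _ hc0]

end CharZero

end MvPolynomial

/-! ### The derivation E and its invariant algebra -/

namespace MvPolynomial

/-- `g` is the common value of the quotients `(∂f/∂xᵢ) / (aᵢ(xᵢ) / bᵢ(xᵢ))`. -/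
def EulerRel {K σ : Type*} [Field K] (a b : σ → K[X]) (f g : MvPolynomial σ K) : Prop :=
  ∀ i, inVar i (b i) * pderiv i f = inVar i (a i) * g

namespace EulerRel

variable {K σ : Type*} [Field K] {a b : σ → K[X]} {f g u v : MvPolynomial σ K}

theorem zero : EulerRel a b (0 : MvPolynomial σ K) 0 := fun i => by simp

theorem const (c : K) : EulerRel a b (C c : MvPolynomial σ K) 0 := fun i => by simp

theorem add (h : EulerRel a b f u) (h' : EulerRel a b g v) : EulerRel a b (f + g) (u + v) :=
  fun i => by rw [map_add, mul_add, mul_add, h i, h' i]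

theorem sub (h : EulerRel a b f u) (h' : EulerRel a b g v) : EulerRel a b (f - g) (u - v) :=
  fun i => by rw [map_sub, mul_sub, mul_sub, h i, h' i]

theorem mul (h : EulerRel a b f u) (h' : EulerRel a b g v) :
    EulerRel a b (f * g) (u * g + f * v) := fun i => by
  rw [pderiv_mul]
  linear_combination g * h i + f * h' i

theorem const_mul (c : K) (h : EulerRel a b f u) :
    EulerRel a b (C c * f) (C c * u) := by
  simpa using (const c).mul h

theorem pow_eigen {l : K} (h : EulerRel a b f (C l * f)) (n : ℕ) :
    EulerRel a b (f ^ n) (C (n * l) * f ^ n) := by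
  induction n with
  | zero => simpa using const (a := a) (b := b) (σ := σ) (1 : K)
  | succ n ih =>
    rw [pow_succ]
    convert ih.mul h using 1
    push_cast
    simp only [map_mul, map_add, map_one]
    ring

theorem aeval_of_one (h : EulerRel a b f 1) (p : K[X]) :
    EulerRel a b (Polynomial.aeval f p) (Polynomial.aeval f (Polynomial.derivative p)) := fun i => by
  rw [Derivation.map_aeval, smul_eq_mul, mul_left_comm, h i, mul_one, mul_comm]

theorem eq_zero_of_pderiv_eq_zero {i : σ} (ha : a i ≠ 0) (h : EulerRel a b f g)
    (hf : pderiv i f = 0) : g = 0 := by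
  have := h i
  rw [hf, mul_zero] at this
  exact (mul_eq_zero.mp this.symm).resolve_left (inVar_ne_zero i ha)

theorem eq_C_of_zero [CharZero K] (hb : ∀ i, b i ≠ 0) (h : EulerRel a b f 0) :
    f = C (coeff 0 f) := by
  refine eq_C_of_pderiv_eq_zero fun i => ?_
  have := h i
  rw [mul_zero] at this
  exact (mul_eq_zero.mp this).resolve_left (inVar_ne_zero i (hb i))

/-- The common quotient is a polynomial: a_i(x_i) divides ∂_i f · b_i(x_i) · a_j(x_j) and is coprime
to the last two factors. A second variable j is essential here. -/
theorem exists_of_cross_mul_eq [CharZero K] [Nontrivial σ] (ha : ∀ i, a i ≠ 0)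
    (hab : ∀ i, IsCoprime (a i) (b i))
    (h : ∀ i j, pderiv i f * inVar i (b i) * inVar j (a j) =
      pderiv j f * inVar j (b j) * inVar i (a i)) : ∃ g, EulerRel a b f g := by
  have hdvd : ∀ i, inVar i (a i) ∣ pderiv i f := by
    intro i
    obtain ⟨j, hj⟩ := exists_ne i
    have h1 : inVar i (a i) ∣ pderiv i f * inVar i (b i) * inVar j (a j) := by
      rw [h i j]; exact dvd_mul_left _ _
    have h2 := (isRelPrime_inVar (σ := σ) hj.symm (ha i) (ha j)).dvd_of_dvd_mul_right h1
    exact ((hab i).map (Polynomial.aeval (X i : MvPolynomial σ K)).toRingHom).dvd_of_dvd_mul_right h2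
  choose q hq using hdvd
  obtain ⟨k⟩ := (inferInstance : Nonempty σ)
  refine ⟨inVar k (b k) * q k, fun i => ?_⟩
  apply mul_left_cancel₀ (inVar_ne_zero k (ha k))
  have := h i k
  rw [hq i, hq k] at this
  rw [hq i]
  linear_combination this

theorem exists_next [CharZero K] [Nontrivial σ] (ha : ∀ i, a i ≠ 0)
    (hab : ∀ i, IsCoprime (a i) (b i)) (h : EulerRel a b f g) :
    ∃ g', EulerRel a b g g' := by
  refine exists_of_cross_mul_eq ha hab fun i j => ?_
  by_cases hij : i = j
  · rw [hij]
  have h1 := congrArg (pderiv j) (h i)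
  have h2 := congrArg (pderiv i) (h j)
  rw [pderiv_mul, pderiv_mul, pderiv_inVar_of_ne hij, pderiv_inVar_of_ne hij, zero_mul, zero_mul,
    zero_add, zero_add] at h1
  rw [pderiv_mul, pderiv_mul, pderiv_inVar_of_ne (Ne.symm hij), pderiv_inVar_of_ne (Ne.symm hij),
    zero_mul, zero_mul, zero_add, zero_add] at h2
  rw [pderiv_pderiv_comm] at h1
  linear_combination inVar j (b j) * h1 - inVar i (b i) * h2

/-! ### Degrees in one variable -/

section Degree

variable [DecidableEq σ]

theorem natDegree_slice_le {i j : σ} (hij : j ≠ i) (ha : ∀ i, a i ≠ 0) (hb : ∀ i, b i ≠ 0)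
    (h : EulerRel a b f g) :
    (slice i (X : σ → MvPolynomial σ K) g).natDegree ≤
      (slice i (X : σ → MvPolynomial σ K) f).natDegree := by
  have h1 := congrArg (slice i (X : σ → MvPolynomial σ K)) (h j)
  rw [map_mul, map_mul, slice_inVar_of_ne hij, slice_inVar_of_ne hij] at h1
  have h2 := congrArg Polynomial.natDegree h1
  rw [Polynomial.natDegree_C_mul (inVar_ne_zero j (hb j)),
    Polynomial.natDegree_C_mul (inVar_ne_zero j (ha j))] at h2
  rw [← h2]
  exact natDegree_slice_pderiv_le hij f

theorem slice_eq (i : σ) (h : EulerRel a b f g) :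
    (b i).map (algebraMap K (MvPolynomial σ K)) *
        Polynomial.derivative (slice i (X : σ → MvPolynomial σ K) f) =
      (a i).map (algebraMap K (MvPolynomial σ K)) * slice i (X : σ → MvPolynomial σ K) g := by
  have h1 := congrArg (slice i (X : σ → MvPolynomial σ K)) (h i)
  rwa [map_mul, map_mul, slice_inVar_self, slice_inVar_self, ← derivative_slice] at h1

/-- Count degrees in x_i: deg b_i + deg f - 1 = deg a_i + deg g, and deg g ≤ deg f. -/
theorem natDegree_den_le [CharZero K] {i j : σ} (hij : j ≠ i) (ha : ∀ i, a i ≠ 0) (hb : ∀ i, b i ≠ 0)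
    (h : EulerRel a b f g) (hg : g ≠ 0) : (b i).natDegree ≤ (a i).natDegree + 1 := by
  have h1 := congrArg Polynomial.natDegree (h.slice_eq i)
  have hinj := (algebraMap K (MvPolynomial σ K)).injective
  have hf : pderiv i f ≠ 0 := fun h0 => hg (h.eq_zero_of_pderiv_eq_zero (ha i) h0)
  have hf' : Polynomial.derivative (slice i (X : σ → MvPolynomial σ K) f) ≠ 0 := fun h0 => by
    rw [derivative_slice] at h0
    exact hf (slice_X_injective i (h0.trans (map_zero _).symm))
  have hg' : slice i (X : σ → MvPolynomial σ K) g ≠ 0 := fun h0 =>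
    hg (slice_X_injective i (h0.trans (map_zero _).symm))
  have hd : (slice i (X : σ → MvPolynomial σ K) f).natDegree ≠ 0 := fun h0 =>
    hf' (Polynomial.derivative_eq_zero.mpr h0)
  rw [Polynomial.natDegree_mul ((Polynomial.map_ne_zero_iff hinj).mpr (hb i)) hf',
    Polynomial.natDegree_mul ((Polynomial.map_ne_zero_iff hinj).mpr (ha i)) hg',
    Polynomial.natDegree_map_eq_of_injective hinj, Polynomial.natDegree_map_eq_of_injective hinj,
    Polynomial.natDegree_derivative] at h1
  have h2 := h.natDegree_slice_le hij ha hb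
  omega

theorem natDegree_slice_sub_le {i j : σ} (hij : j ≠ i) (ha : ∀ i, a i ≠ 0) (hb : ∀ i, b i ≠ 0)
    (hdeg : (b i).natDegree ≤ (a i).natDegree + 1) (h : EulerRel a b f g) {n : ℕ}
    (hn : (slice i (X : σ → MvPolynomial σ K) f).natDegree ≤ n + 1) :
    (slice i (X : σ → MvPolynomial σ K)
      (g - C ((b i).coeff ((a i).natDegree + 1) / (a i).leadingCoeff *
        ((n + 1 : ℕ) : K)) * f)).natDegree ≤ n := by
  have hinj := (algebraMap K (MvPolynomial σ K)).injective
  have hg := (h.natDegree_slice_le hij ha hb).trans hn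
  have hl : (a i).leadingCoeff ≠ 0 := Polynomial.leadingCoeff_ne_zero.mpr (ha i)
  -- This is the highest degree either side can reach, so only one product of coefficients survives
  -- on each side.
  have h1 := congrArg (fun p => Polynomial.coeff p ((a i).natDegree + 1 + n)) (h.slice_eq i)
  have hd : (Polynomial.derivative (slice i (X : σ → MvPolynomial σ K) f)).natDegree ≤ n :=
    (Polynomial.natDegree_derivative_le _).trans (by omega)
  rw [Polynomial.coeff_mul_add_eq_of_natDegree_le
    (by rwa [Polynomial.natDegree_map_eq_of_injective hinj]) hd,
    add_assoc, add_comm 1 n, Polynomial.coeff_mul_add_eq_of_natDegree_le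
    (by rw [Polynomial.natDegree_map_eq_of_injective hinj]) hg, Polynomial.coeff_derivative,
    Polynomial.coeff_map, Polynomial.coeff_map, Polynomial.coeff_natDegree] at h1
  rw [map_sub, map_mul, slice_C, algebraMap_eq]
  rw [Polynomial.natDegree_le_iff_coeff_eq_zero]
  intro m hm
  rw [Polynomial.coeff_sub, Polynomial.coeff_C_mul]
  rcases Nat.lt_or_eq_of_le (Nat.succ_le_of_lt hm) with hm' | rfl
  · rw [Polynomial.coeff_eq_zero_of_natDegree_lt (hg.trans_lt hm'),
      Polynomial.coeff_eq_zero_of_natDegree_lt (hn.trans_lt hm'), mul_zero, sub_zero]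
  · apply mul_left_cancel₀ ((map_ne_zero_iff _ hinj).mpr hl)
    have hC' : C (a i).leadingCoeff * C ((b i).coeff ((a i).natDegree + 1) /
        (a i).leadingCoeff * ((n + 1 : ℕ) : K)) =
          C ((b i).coeff ((a i).natDegree + 1)) * ((n : MvPolynomial σ K) + 1) := by
      rw [← C_mul, ← mul_assoc, mul_div_cancel₀ _ hl]
      simp
    rw [mul_zero, mul_sub, ← h1, algebraMap_eq]
    linear_combination -(slice i X f).coeff (n + 1) * hC'

end Degree

/-! ### Eigenvectors are products -/

theorem eigen_eq_C_mul [CharZero K] (hb : ∀ i, b i ≠ 0) {l : K} (hv : v ≠ 0)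
    (hu' : EulerRel a b u (C l * u)) (hv' : EulerRel a b v (C l * v)) :
    ∃ c : K, u = C c * v := by
  refine exists_eq_C_mul_of_wronskian_eq_zero hv fun i => ?_
  apply mul_left_cancel₀ (inVar_ne_zero i (hb i))
  linear_combination v * hu' i - u * hv' i

theorem eigen_eq_prod [CharZero K] [Fintype σ] (hb : ∀ i, b i ≠ 0)
    {l : K} (hu : u ≠ 0) (h : EulerRel a b u (C l * u)) :
    ∃ (c : K) (p : σ → K[X]), u = C c * ∏ i, inVar i (p i) := by
  classical
  -- Slices through a point where u does not vanish are nonzero. Their product has the same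
  -- eigenvalue as u, hence is proportional to it.
  obtain ⟨z, hz⟩ : ∃ z : σ → K, aeval z u ≠ 0 := by
    by_contra! h0
    exact hu (MvPolynomial.funext fun z => by simpa [aeval_eq_eval] using h0 z)
  have hp : ∀ i, slice i z u ≠ 0 := fun i h0 => by
    have := eval_slice i z (z i) u
    rw [h0, Polynomial.eval_zero, Function.update_eq_self] at this
    exact hz this.symm
  have hd : ∀ i, b i * Polynomial.derivative (slice i z u) =
      a i * (Polynomial.C l * slice i z u) := by
    intro i
    have := congrArg (slice i z) (h i)
    rwa [map_mul, map_mul, map_mul, slice_inVar_self, slice_inVar_self, Algebra.algebraMap_self,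
      Polynomial.map_id, Polynomial.map_id, slice_C, Algebra.algebraMap_self_apply, ← derivative_slice] at this
  obtain ⟨c, hc⟩ := eigen_eq_C_mul (v := ∏ i, inVar i (slice i z u)) hb
    (Finset.prod_ne_zero_iff.mpr fun i _ => inVar_ne_zero i (hp i)) h fun i => by
      have := congrArg (inVar (σ := σ) i) (hd i)
      simp only [inVar, map_mul, Polynomial.aeval_C, algebraMap_eq] at this
      rw [pderiv_prod_inVar, ← mul_assoc, this, ← Finset.mul_prod_erase _ _ (Finset.mem_univ i)]
      ring
  exact ⟨c, _, hc⟩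

theorem exists_eq_C_mul_pow [CharZero K] (hb : ∀ i, b i ≠ 0) {k : K} {n : ℕ}
    (hn : 0 < n) (hv : v ≠ 0) (hv' : EulerRel a b v (C (k * (n : K)) * v))
    (hmin : ∀ m < n, 0 < m → ∀ u, EulerRel a b u (C (k * (m : K)) * u) → u = 0) (m : ℕ)
    (h : EulerRel a b u (C (k * (m : K)) * u)) : ∃ (c : K) (j : ℕ), u = C c * v ^ j := by
  induction m using Nat.strong_induction_on generalizing u with
  | _ m ih =>
    by_cases hu : u = 0
    · exact ⟨0, 0, by simp [hu]⟩
    rcases Nat.eq_zero_or_pos m with rfl | hm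
    · refine ⟨coeff 0 u, 0, ?_⟩
      rw [pow_zero, mul_one]
      refine EulerRel.eq_C_of_zero (a := a) hb ?_
      simpa using h
    have hnm : n ≤ m := by
      by_contra! hlt
      exact hu (hmin m hlt hm u h)
    -- Both powers have eigenvalue knm, and eigenspaces are lines.
    obtain ⟨c, hc⟩ : ∃ c : K, v ^ m = C c * u ^ n := by
      refine eigen_eq_C_mul (a := a) (l := k * n * m) hb (pow_ne_zero _ hu) ?_ ?_
      · convert hv'.pow_eigen m using 3
        ring
      · convert h.pow_eigen n using 3
        ring
    have hc0 : c ≠ 0 := by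
      rintro rfl
      rw [C_0, zero_mul] at hc
      exact pow_ne_zero _ hv hc
    -- Since n ≤ m, v^n divides v^m and so u^n; the ring is integrally closed, so v divides u. The
    -- quotient has eigenvalue k(m-n), and the induction continues.
    have hdvd : v ∣ u := by
      rw [← IsIntegrallyClosed.pow_dvd_pow_iff hn.ne']
      have h1 : u ^ n = C c⁻¹ * v ^ m := by
        rw [hc, ← mul_assoc, ← C_mul, inv_mul_cancel₀ hc0, C_1, one_mul]
      rw [h1]
      exact (pow_dvd_pow v hnm).mul_left _
    obtain ⟨q, rfl⟩ := hdvd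
    obtain ⟨c', j, hq⟩ := ih (m - n) (by omega) (u := q) fun i => by
      apply mul_left_cancel₀ hv
      have h1 := h i
      rw [pderiv_mul] at h1
      rw [Nat.cast_sub hnm, mul_sub, C_sub]
      linear_combination h1 - q * hv' i
    exact ⟨c', j + 1, by rw [hq]; ring⟩

/-- The restrictions of u to the coordinate axes are antiderivatives of a_i/b_i. E maps their sum to
1 too, so u differs from it by a constant. -/
theorem eq_sum_of_one [CharZero K] [Fintype σ] (hb : ∀ i, b i ≠ 0) (h : EulerRel a b u 1) :
    ∃ (c : K) (p : σ → K[X]), u = C c + ∑ i, inVar i (p i) := by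
  classical
  have hd : ∀ i, b i * Polynomial.derivative (slice i (0 : σ → K) u) = a i := by
    intro i
    have := congrArg (slice i (0 : σ → K)) (h i)
    rwa [map_mul, map_mul, map_one, mul_one, slice_inVar_self, slice_inVar_self,
      Algebra.algebraMap_self, Polynomial.map_id, Polynomial.map_id, ← derivative_slice] at this
  have h' : EulerRel a b (u - ∑ i, inVar i (slice i (0 : σ → K) u)) 0 := by
    have h1 : EulerRel a b (∑ i, inVar i (slice i (0 : σ → K) u)) 1 := fun i => by
      rw [pderiv_sum_inVar, mul_one, ← map_mul, hd i]
    simpa only [sub_self] using h.sub h1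
  exact ⟨_, _, sub_eq_iff_eq_add.mp (h'.eq_C_of_zero hb)⟩

end EulerRel

end MvPolynomial

theorem Polynomial.derivative_surjective_of_charZero {K : Type*} [Field K] [CharZero K] :
    Function.Surjective (derivative : K[X] → K[X]) := by
  intro p
  induction p using Polynomial.induction_on' with
  | add p q hp hq =>
    obtain ⟨p', rfl⟩ := hp
    obtain ⟨q', rfl⟩ := hq
    exact ⟨p' + q', derivative_add⟩
  | monomial n c =>
    refine ⟨monomial (n + 1) (c / ((n : K) + 1)), ?_⟩
    rw [derivative_monomial, Nat.cast_add_one, div_mul_cancel₀ _ (Nat.cast_add_one_ne_zero n),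
      Nat.add_sub_cancel]

namespace MvPolynomial

namespace EulerRel

variable {K σ : Type*} [Field K] [CharZero K] [Nontrivial σ] {a b : σ → K[X]}
  {f g u v : MvPolynomial σ K}

/-! ### The locally nilpotent case -/

/-- The last nonzero iterate of E on f is a constant; rescale the iterate before it. -/
theorem exists_eulerRel_one [DecidableEq σ] {i : σ} (ha : ∀ i, a i ≠ 0) (hb : ∀ i, b i ≠ 0)
    (hab : ∀ i, IsCoprime (a i) (b i))
    (hdrop : ∀ (f g : MvPolynomial σ K) (n : ℕ), EulerRel a b f g →
      (slice i (X : σ → MvPolynomial σ K) f).natDegree ≤ n + 1 →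
      (slice i (X : σ → MvPolynomial σ K) g).natDegree ≤ n) {n : ℕ}
    (hn : (slice i (X : σ → MvPolynomial σ K) f).natDegree ≤ n) (h : EulerRel a b f g)
    (hg : g ≠ 0) : ∃ s, EulerRel a b s 1 := by
  induction n generalizing f g with
  | zero =>
    exact absurd (h.eq_zero_of_pderiv_eq_zero (ha i)
      (pderiv_eq_zero_of_natDegree_slice (Nat.le_zero.mp hn))) hg
  | succ n ih =>
    obtain ⟨g', hg'⟩ := h.exists_next ha hab
    by_cases h0 : g' = 0
    · rw [h0] at hg'
      have hc := hg'.eq_C_of_zero hb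
      have hc0 : coeff 0 g ≠ 0 := fun hc0 => hg (by rw [hc, hc0, C_0])
      refine ⟨C (coeff 0 g)⁻¹ * f, ?_⟩
      have := h.const_mul (coeff 0 g)⁻¹
      rwa [hc, ← C_mul, coeff_C, if_pos rfl, inv_mul_cancel₀ hc0, C_1] at this
    · exact ih (hdrop f g n h hn) hg' h0

theorem exists_eq_aeval_of_one [DecidableEq σ] {i : σ} (ha : ∀ i, a i ≠ 0) (hb : ∀ i, b i ≠ 0)
    (hab : ∀ i, IsCoprime (a i) (b i))
    (hdrop : ∀ (f g : MvPolynomial σ K) (n : ℕ), EulerRel a b f g →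
      (slice i (X : σ → MvPolynomial σ K) f).natDegree ≤ n + 1 →
      (slice i (X : σ → MvPolynomial σ K) g).natDegree ≤ n) {s : MvPolynomial σ K}
    (hs : EulerRel a b s 1) {n : ℕ}
    (hn : (slice i (X : σ → MvPolynomial σ K) f).natDegree ≤ n) (h : EulerRel a b f g) :
    ∃ p : K[X], f = Polynomial.aeval s p := by
  induction n generalizing f g with
  | zero =>
    rw [h.eq_zero_of_pderiv_eq_zero (ha i)
      (pderiv_eq_zero_of_natDegree_slice (Nat.le_zero.mp hn))] at h
    refine ⟨Polynomial.C (coeff 0 f), ?_⟩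
    rw [Polynomial.aeval_C]
    exact h.eq_C_of_zero hb
  | succ n ih =>
    obtain ⟨g', hg'⟩ := h.exists_next ha hab
    obtain ⟨p, hp⟩ := ih (hdrop f g n h hn) hg'
    obtain ⟨q, rfl⟩ : ∃ q : K[X], Polynomial.derivative q = p :=
      Polynomial.derivative_surjective_of_charZero p
    have h0 := h.sub (hs.aeval_of_one q)
    rw [hp, sub_self] at h0
    refine ⟨Polynomial.C (coeff 0 (f - Polynomial.aeval s q)) + q, ?_⟩
    rw [map_add, Polynomial.aeval_C, algebraMap_eq, ← h0.eq_C_of_zero hb, sub_add_cancel]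

/-! ### The semisimple case -/

/-- With l = k(n+1), (E - l) f has lower degree, so by induction it equals (E - l) y with y in the
span of the lower eigenvectors. Then f - y is an eigenvector for l. -/
theorem mem_span_eigen [DecidableEq σ] {i : σ} (ha : ∀ i, a i ≠ 0)
    (hab : ∀ i, IsCoprime (a i) (b i)) {k : K} (hk : k ≠ 0)
    (hdrop : ∀ (f g : MvPolynomial σ K) (n : ℕ), EulerRel a b f g →
      (slice i (X : σ → MvPolynomial σ K) f).natDegree ≤ n + 1 →
      (slice i (X : σ → MvPolynomial σ K) (g - C (k * ((n + 1 : ℕ) : K)) * f)).natDegree ≤ n)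
    {n : ℕ} (hn : (slice i (X : σ → MvPolynomial σ K) f).natDegree ≤ n)
    (h : EulerRel a b f g) :
    f ∈ Submodule.span K {u | ∃ m ≤ n, EulerRel a b u (C (k * (m : K)) * u)} := by
  induction n generalizing f g with
  | zero =>
    apply Submodule.subset_span
    refine ⟨0, le_rfl, ?_⟩
    rw [h.eq_zero_of_pderiv_eq_zero (ha i)
      (pderiv_eq_zero_of_natDegree_slice (Nat.le_zero.mp hn))] at h
    simpa using h
  | succ n ih =>
    set l : K := k * ((n + 1 : ℕ) : K) with hl
    obtain ⟨g', hg'⟩ := h.exists_next ha hab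
    have hmem := ih (hdrop f g n h hn) (hg'.sub (h.const_mul l))
    have hmono : Submodule.span K {u | ∃ m ≤ n, EulerRel a b u (C (k * (m : K)) * u)} ≤
        Submodule.span K {u | ∃ m ≤ n + 1, EulerRel a b u (C (k * (m : K)) * u)} :=
      Submodule.span_mono fun u ⟨m, hm, hu⟩ => ⟨m, hm.trans n.le_succ, hu⟩
    -- `E - l` is invertible on the span of the eigenvectors with smaller eigenvalues.
    have hinv : ∀ x ∈ Submodule.span K {u | ∃ m ≤ n, EulerRel a b u (C (k * (m : K)) * u)},
        ∃ y ∈ Submodule.span K {u | ∃ m ≤ n, EulerRel a b u (C (k * (m : K)) * u)},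
          EulerRel a b y (x + C l * y) := by
      intro x hx
      induction hx using Submodule.span_induction with
      | mem u hu =>
        obtain ⟨m, hm, hu⟩ := hu
        have hne : k * (m : K) - l ≠ 0 := by
          rw [hl, ← mul_sub]
          refine mul_ne_zero hk (sub_ne_zero.mpr ?_)
          exact_mod_cast (by omega : m ≠ n + 1)
        refine ⟨C (k * (m : K) - l)⁻¹ * u, ?_, ?_⟩
        · rw [← smul_eq_C_mul]
          exact Submodule.smul_mem _ _ (Submodule.subset_span ⟨m, hm, hu⟩)
        · convert hu.const_mul (k * (m : K) - l)⁻¹ using 1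
          have : (C (k * (m : K) - l)⁻¹ : MvPolynomial σ K) * C (k * (m : K) - l) = 1 := by
            rw [← C_mul, inv_mul_cancel₀ hne, C_1]
          rw [C_sub] at this
          linear_combination -u * this
      | zero => exact ⟨0, Submodule.zero_mem _, by simpa using EulerRel.zero⟩
      | add x x' _ _ hx hx' =>
        obtain ⟨y, hy, h1⟩ := hx
        obtain ⟨y', hy', h2⟩ := hx'
        refine ⟨y + y', Submodule.add_mem _ hy hy', ?_⟩
        convert h1.add h2 using 1
        ring
      | smul c x _ hx =>
        obtain ⟨y, hy, h1⟩ := hx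
        refine ⟨c • y, Submodule.smul_mem _ _ hy, ?_⟩
        rw [smul_eq_C_mul, smul_eq_C_mul]
        convert h1.const_mul c using 1
        ring
    obtain ⟨y, hy, hrel⟩ := hinv _ hmem
    rw [← sub_add_cancel f y]
    refine Submodule.add_mem _ (Submodule.subset_span ⟨n + 1, le_rfl, ?_⟩) (hmono hy)
    convert h.sub hrel using 1
    ring

theorem exists_form [Fintype σ] (ha : ∀ i, a i ≠ 0) (hb : ∀ i, b i ≠ 0)
    (hab : ∀ i, IsCoprime (a i) (b i)) (h : EulerRel a b f g) :
    (∃ (q : K[X]) (p : σ → K[X]), f = Polynomial.aeval (∑ i, inVar i (p i)) q) ∨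
      ∃ (q : K[X]) (p : σ → K[X]), f = Polynomial.aeval (∏ i, inVar i (p i)) q := by
  classical
  by_cases hg : g = 0
  · rw [hg] at h
    refine Or.inl ⟨Polynomial.C (coeff 0 f), 0, ?_⟩
    rw [Polynomial.aeval_C]
    exact h.eq_C_of_zero hb
  obtain ⟨i, j, hij⟩ := exists_pair_ne σ
  have hdeg := h.natDegree_den_le hij.symm ha hb hg
  set k : K := (b i).coeff ((a i).natDegree + 1) / (a i).leadingCoeff with hk
  have hdrop : ∀ (f g : MvPolynomial σ K) (n : ℕ), EulerRel a b f g →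
      (slice i (X : σ → MvPolynomial σ K) f).natDegree ≤ n + 1 →
      (slice i (X : σ → MvPolynomial σ K) (g - C (k * ((n + 1 : ℕ) : K)) * f)).natDegree ≤ n :=
    fun f g n h hn => h.natDegree_slice_sub_le hij.symm ha hb hdeg hn
  by_cases hk0 : k = 0
  · left
    have hdrop' : ∀ (f g : MvPolynomial σ K) (n : ℕ), EulerRel a b f g →
        (slice i (X : σ → MvPolynomial σ K) f).natDegree ≤ n + 1 →
        (slice i (X : σ → MvPolynomial σ K) g).natDegree ≤ n := fun f g n h hn => by
      have := hdrop f g n h hn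
      rwa [hk0, zero_mul, C_0, zero_mul, sub_zero] at this
    obtain ⟨s, hs⟩ := exists_eulerRel_one ha hb hab hdrop' le_rfl h hg
    obtain ⟨q, hq⟩ := exists_eq_aeval_of_one ha hb hab hdrop' hs le_rfl h
    obtain ⟨c, p, hp⟩ := hs.eq_sum_of_one hb
    refine ⟨q.comp (Polynomial.X + Polynomial.C c), p, ?_⟩
    rw [Polynomial.aeval_comp, hq, hp]
    simp [add_comm]
  · have hmem := mem_span_eigen ha hab hk0 hdrop le_rfl h
    by_cases hex : ∃ n : ℕ, 0 < n ∧ ∃ v : MvPolynomial σ K, v ≠ 0 ∧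
        EulerRel a b v (C (k * (n : K)) * v)
    · right
      obtain ⟨hn, v, hv, hv'⟩ := Nat.find_spec hex
      have hmin : ∀ m < Nat.find hex, 0 < m →
          ∀ u, EulerRel a b u (C (k * (m : K)) * u) → u = 0 := by
        intro m hm hm0 u hu
        by_contra hu0
        exact Nat.find_min hex hm ⟨hm0, u, hu0, hu⟩
      have hle : Submodule.span K {u | ∃ m ≤ (slice i (X : σ → MvPolynomial σ K) f).natDegree,
          EulerRel a b u (C (k * (m : K)) * u)} ≤
            Subalgebra.toSubmodule (Polynomial.aeval (R := K) v).range := by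
        rw [Submodule.span_le]
        rintro u ⟨m, -, hu⟩
        obtain ⟨c, j, rfl⟩ := exists_eq_C_mul_pow hb hn hv hv' hmin m hu
        exact ⟨Polynomial.C c * Polynomial.X ^ j, by simp⟩
      obtain ⟨q, hq⟩ := hle hmem
      obtain ⟨c, p, hp⟩ := hv'.eigen_eq_prod hb hv
      -- The scalar c in v = c ∏ p_i(x_i) is absorbed into the outer polynomial.
      refine ⟨q.comp (Polynomial.C c * Polynomial.X), p, ?_⟩
      rw [Polynomial.aeval_comp, ← hq, hp]
      simp
    · left
      push Not at hex
      -- Only the eigenvalue 0 remains, and its eigenvectors are constants.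
      have hle : Submodule.span K {u | ∃ m ≤ (slice i (X : σ → MvPolynomial σ K) f).natDegree,
          EulerRel a b u (C (k * (m : K)) * u)} ≤
            Subalgebra.toSubmodule (⊥ : Subalgebra K (MvPolynomial σ K)) := by
        rw [Submodule.span_le]
        rintro u ⟨m, -, hu⟩
        rcases Nat.eq_zero_or_pos m with rfl | hm
        · rw [Nat.cast_zero, mul_zero, C_0, zero_mul] at hu
          exact Algebra.mem_bot.mpr ⟨_, (hu.eq_C_of_zero hb).symm⟩
        · have : u = 0 := by
            by_contra hu0
            exact hex m hm u hu0 hu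
          rw [this]
          exact zero_mem _
      obtain ⟨c, hc⟩ := Algebra.mem_bot.mp (hle hmem)
      exact ⟨Polynomial.C c, 0, by rw [Polynomial.aeval_C, hc]⟩

end EulerRel

end MvPolynomial

/-! ### Real and imaginary parts of complex polynomials -/

namespace Polynomial

theorem exists_re_add_im (p : ℂ[X]) : ∃ u v : ℝ[X],
    p = u.map (algebraMap ℝ ℂ) + C Complex.I * v.map (algebraMap ℝ ℂ) := by
  induction p using Polynomial.induction_on' with
  | add p q hp hq =>
    obtain ⟨u, v, rfl⟩ := hp
    obtain ⟨u', v', rfl⟩ := hq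
    exact ⟨u + u', v + v', by simp only [Polynomial.map_add]; ring⟩
  | monomial n c =>
    refine ⟨monomial n c.re, monomial n c.im, ?_⟩
    rw [map_monomial, map_monomial, C_mul_monomial, ← map_add, mul_comm]
    exact congrArg _ (Complex.re_add_im c).symm

theorem exists_map_eq_of_map_conj_eq {p : ℂ[X]} (h : p.map (starRingEnd ℂ) = p) :
    ∃ q : ℝ[X], q.map (algebraMap ℝ ℂ) = p := by
  obtain ⟨u, v, huv⟩ := exists_re_add_im p
  refine ⟨u, ?_⟩
  ext n
  have h1 := congrArg (fun q => (coeff q n).im) h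
  have h2 := congrArg (fun q => (coeff q n).im) huv
  rw [huv, coeff_add, coeff_C_mul, coeff_map, coeff_map]
  simp only [coeff_map, Complex.conj_im] at h1
  have h3 : (p.coeff n).im = 0 := by linarith
  rw [h3] at h2
  simp only [coeff_add, coeff_C_mul, coeff_map, Complex.coe_algebraMap, Complex.add_im,
    Complex.ofReal_im, Complex.I_mul_im, Complex.ofReal_re, zero_add] at h2
  simp [← h2]

theorem exists_real_eval_ne_zero {p : ℂ[X]} (hp : p ≠ 0) : ∃ t : ℝ, p.eval (t : ℂ) ≠ 0 := by
  by_contra! h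
  refine hp (eq_zero_of_infinite_isRoot p ?_)
  refine (Set.infinite_range_of_injective Complex.ofReal_injective).mono ?_
  rintro _ ⟨t, rfl⟩
  exact h t

theorem eval_map_conj_ofReal (p : ℂ[X]) (t : ℝ) :
    (p.map (starRingEnd ℂ)).eval (t : ℂ) = starRingEnd ℂ (p.eval (t : ℂ)) := by
  have := Polynomial.eval_map_apply (starRingEnd ℂ) (p := p) (t : ℂ)
  rwa [Complex.conj_ofReal] at this

/-- If `p` is a constant multiple of a polynomial with real coefficients, in the sense that
`p · w̄ = p̄ · w`, then `p / w` has real coefficients. -/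
theorem exists_eq_C_mul_map {p : ℂ[X]} {w : ℂ} (hw : w ≠ 0)
    (h : p * C (starRingEnd ℂ w) = p.map (starRingEnd ℂ) * C w) :
    ∃ q : ℝ[X], p = C w * q.map (algebraMap ℝ ℂ) := by
  have hw' : starRingEnd ℂ w ≠ 0 := (_root_.map_ne_zero _).mpr hw
  obtain ⟨q, hq⟩ := exists_map_eq_of_map_conj_eq (p := C w⁻¹ * p) (by
    rw [Polynomial.map_mul, map_C, map_inv₀]
    apply mul_left_cancel₀ (mul_ne_zero (C_ne_zero.mpr hw) (C_ne_zero.mpr hw'))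
    have h1 : C w * C w⁻¹ = (1 : ℂ[X]) := by rw [← C_mul, mul_inv_cancel₀ hw, C_1]
    have h2 : C (starRingEnd ℂ w) * C (starRingEnd ℂ w)⁻¹ = (1 : ℂ[X]) := by
      rw [← C_mul, mul_inv_cancel₀ hw', C_1]
    linear_combination C w * p.map (starRingEnd ℂ) * h2 - h - p * C (starRingEnd ℂ w) * h1)
  refine ⟨q, ?_⟩
  rw [hq, ← mul_assoc, ← C_mul, mul_inv_cancel₀ hw, C_1, one_mul]

end Polynomial

namespace MvPolynomial

theorem map_aeval_polynomial {K L σ : Type*} [Field K] [Field L] (φ : K →+* L)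
    (P : MvPolynomial σ K) (h : K[X]) :
    map φ (Polynomial.aeval P h) = Polynomial.aeval (map φ P) (h.map φ) := by
  rw [Polynomial.aeval_def, Polynomial.hom_eval₂, Polynomial.aeval_def, Polynomial.eval₂_map]
  congr 1
  ext c
  simp [algebraMap_eq]

theorem map_inVar {K L σ : Type*} [Field K] [Field L] (φ : K →+* L) (i : σ) (p : K[X]) :
    map φ (inVar i p) = inVar i (p.map φ) := by
  rw [inVar, map_aeval_polynomial, map_X]

theorem exists_eq_aeval_of_map_eq {σ : Type*} {g Q : MvPolynomial σ ℝ} {h : ℂ[X]}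
    (hg : map (algebraMap ℝ ℂ) g = Polynomial.aeval (map (algebraMap ℝ ℂ) Q) h) :
    ∃ q : ℝ[X], g = Polynomial.aeval Q q := by
  obtain ⟨u, v, rfl⟩ := h.exists_re_add_im
  refine ⟨u, ?_⟩
  rw [map_add, map_mul, Polynomial.aeval_C, ← map_aeval_polynomial, ← map_aeval_polynomial,
    algebraMap_eq] at hg
  ext m
  have := congrArg (fun p => (coeff m p).re) hg
  simpa [coeff_map] using this

/-- Isolates the trivial cases: the main arguments compare two variables on which the polynomial
really depends. -/
theorem eq_C_or_eq_inVar_or_two_pderiv_ne_zero {K σ : Type*} [Field K] [CharZero K]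
    (g : MvPolynomial σ K) : (∃ c, g = C c) ∨ (∃ i q, g = inVar i q) ∨
      ∃ i j, i ≠ j ∧ pderiv i g ≠ 0 ∧ pderiv j g ≠ 0 := by
  classical
  by_cases h0 : ∀ i, pderiv i g = 0
  · exact Or.inl ⟨_, eq_C_of_pderiv_eq_zero h0⟩
  push Not at h0
  obtain ⟨i, hi⟩ := h0
  by_cases hj : ∃ j, i ≠ j ∧ pderiv j g ≠ 0
  · obtain ⟨j, hij, hj⟩ := hj
    exact Or.inr (Or.inr ⟨i, j, hij, hi, hj⟩)
  push Not at hj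
  refine Or.inr (Or.inl ⟨i, ?_⟩)
  clear hi
  induction hn : (slice i (X : σ → MvPolynomial σ K) g).natDegree using Nat.strong_induction_on
    generalizing g with
  | _ n ih =>
    by_cases hn0 : n = 0
    · have hi := pderiv_eq_zero_of_natDegree_slice (hn.trans hn0)
      refine ⟨Polynomial.C (coeff 0 g), ?_⟩
      rw [inVar, Polynomial.aeval_C]
      refine eq_C_of_pderiv_eq_zero fun j => ?_
      by_cases hij : i = j
      · rwa [← hij]
      · exact hj j hij
    · obtain ⟨q, hq⟩ := ih _ (by
        rw [← hn, ← derivative_slice]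
        exact Polynomial.natDegree_derivative_lt (by rwa [hn])) (pderiv i g)
        (fun j hij => by rw [pderiv_pderiv_comm, hj j hij, map_zero]) rfl
      obtain ⟨q, rfl⟩ := Polynomial.derivative_surjective_of_charZero q
      refine ⟨q + Polynomial.C (coeff 0 (g - inVar i q)), ?_⟩
      rw [inVar, map_add, Polynomial.aeval_C, ← sub_eq_iff_eq_add']
      refine eq_C_of_pderiv_eq_zero fun j => ?_
      by_cases hij : i = j
      · rw [← hij, map_sub, hq, pderiv_inVar_self, sub_self]
      · rw [map_sub, hj j hij, pderiv_inVar_of_ne hij, sub_self]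

/-! ### Descent from complex to real coefficients -/

section Real

variable {σ : Type*}

/-- Each nonzero s_k has the same quotient s_k / s̄_k = N/M. It depends on x_k alone for at least
two k, so it is constant, and all s_k share one phase w. -/
theorem exists_forall_eq_C_mul_map {s : σ → ℂ[X]} {M N : MvPolynomial σ ℂ} (hM : M ≠ 0)
    (hN : N ≠ 0)
    (h : ∀ i, M * inVar i (s i) = N * inVar i ((s i).map (starRingEnd ℂ))) {i j : σ}
    (hij : i ≠ j) (hi : s i ≠ 0) (hj : s j ≠ 0) :
    ∃ w : ℂ, w ≠ 0 ∧ ∀ k, ∃ q : ℝ[X], s k = Polynomial.C w * q.map (algebraMap ℝ ℂ) := by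
  classical
  have hcross : ∀ k l, k ≠ l → ∀ t : ℝ, (s l).eval (t : ℂ) ≠ 0 →
      ∃ q : ℝ[X], s k = Polynomial.C ((s l).eval (t : ℂ)) * q.map (algebraMap ℝ ℂ) := by
    intro k l hkl t ht
    apply Polynomial.exists_eq_C_mul_map ht
    have h1 : inVar k (s k) * inVar l ((s l).map (starRingEnd ℂ)) =
        inVar k ((s k).map (starRingEnd ℂ)) * inVar l (s l) := by
      apply mul_left_cancel₀ (mul_ne_zero hM hN)
      linear_combination N * inVar l ((s l).map (starRingEnd ℂ)) * h k -
        N * inVar k ((s k).map (starRingEnd ℂ)) * h l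
    have h2 := congrArg (slice k (fun _ => (t : ℂ))) h1
    rw [map_mul, map_mul, slice_inVar_self, slice_inVar_self, slice_inVar_of_ne hkl.symm,
      slice_inVar_of_ne hkl.symm, Algebra.algebraMap_self, Polynomial.map_id, Polynomial.map_id,
      Polynomial.coe_aeval_eq_eval, Polynomial.eval_map_conj_ofReal] at h2
    exact h2
  obtain ⟨t, ht⟩ := Polynomial.exists_real_eval_ne_zero hj
  refine ⟨_, ht, fun k => ?_⟩
  by_cases hkj : k = j
  -- For k = j, compare with i instead: s_i(t') is a real multiple of w = s_j(t).
  · obtain ⟨t', ht'⟩ := Polynomial.exists_real_eval_ne_zero hi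
    obtain ⟨q, hq⟩ := hcross i j hij t ht
    obtain ⟨q', hq'⟩ := hcross j i hij.symm t' ht'
    refine ⟨Polynomial.C (q.eval t') * q', ?_⟩
    have h1 : (s i).eval (t' : ℂ) = (s j).eval (t : ℂ) * algebraMap ℝ ℂ (q.eval t') := by
      rw [hq, Polynomial.eval_mul, Polynomial.eval_C]
      congr 1
      exact Polynomial.eval_map_apply (algebraMap ℝ ℂ) t'
    rw [hkj, Polynomial.map_mul, Polynomial.map_C, ← mul_assoc, ← Polynomial.C_mul, ← h1, ← hq']
  · exact hcross k j hkj t ht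

theorem map_conj_map (g : MvPolynomial σ ℝ) :
    map (starRingEnd ℂ) (map (algebraMap ℝ ℂ) g) = map (algebraMap ℝ ℂ) g := by
  rw [map_map]
  congr 2
  ext x
  simp

theorem pderiv_map_ne_zero {g : MvPolynomial σ ℝ} {i : σ} (h : pderiv i g ≠ 0) :
    pderiv i (map (algebraMap ℝ ℂ) g) ≠ 0 := by
  rw [pderiv_map]
  exact fun h0 => h (map_injective _ (algebraMap ℝ ℂ).injective (h0.trans (map_zero _).symm))

variable [Fintype σ]

/-- By the chain rule ∂_k g = M p_k'(x_k), and conjugation fixes the left side. So all p_k' are real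
up to one factor w; integrating gives p_k = w r_k + c_k. -/
theorem exists_real_additive {g : MvPolynomial σ ℝ} {h : ℂ[X]} {p : σ → ℂ[X]}
    (hg : map (algebraMap ℝ ℂ) g = Polynomial.aeval (∑ i, inVar i (p i)) h) :
    ∃ (q : ℝ[X]) (r : σ → ℝ[X]), g = Polynomial.aeval (∑ i, inVar i (r i)) q := by
  classical
  rcases eq_C_or_eq_inVar_or_two_pderiv_ne_zero g with ⟨c, rfl⟩ | ⟨i, q, rfl⟩ | ⟨i, j, hij, hi, hj⟩
  · exact ⟨Polynomial.C c, 0, by rw [Polynomial.aeval_C]; rfl⟩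
  · refine ⟨q, Pi.single i Polynomial.X, ?_⟩
    rw [Finset.sum_eq_single i (fun j _ hj => by simp [Pi.single_eq_of_ne hj]) (by simp)]
    simp
  set M := Polynomial.aeval (∑ i, inVar i (p i)) (Polynomial.derivative h) with hM
  have hd : ∀ k, pderiv k (map (algebraMap ℝ ℂ) g) =
      M * inVar k (Polynomial.derivative (p k)) := fun k => by
    rw [hg, Derivation.map_aeval, pderiv_sum_inVar, smul_eq_mul]
  have hd' : ∀ k, pderiv k (map (algebraMap ℝ ℂ) g) = map (starRingEnd ℂ) M *
      inVar k ((Polynomial.derivative (p k)).map (starRingEnd ℂ)) := fun k => by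
    rw [← map_inVar, ← map_mul, ← hd, ← pderiv_map, map_conj_map]
  have hi' := pderiv_map_ne_zero hi
  have hj' := pderiv_map_ne_zero hj
  have hM0 : M ≠ 0 := fun h0 => hi' (by rw [hd, h0, zero_mul])
  have hN0 : map (starRingEnd ℂ) M ≠ 0 := fun h0 => hi' (by rw [hd', h0, zero_mul])
  obtain ⟨w, hw, hq⟩ := exists_forall_eq_C_mul_map hM0 hN0
    (fun k => (hd k).symm.trans (hd' k)) hij
    (fun h0 => hi' (by rw [hd, h0, inVar_zero, mul_zero]))
    (fun h0 => hj' (by rw [hd, h0, inVar_zero, mul_zero]))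
  choose q hq using hq
  choose r hr using fun k => Polynomial.derivative_surjective_of_charZero (q k)
  have hp : ∀ k, ∃ c, p k = Polynomial.C w * (r k).map (algebraMap ℝ ℂ) + Polynomial.C c := by
    intro k
    have h0 : Polynomial.derivative (p k - Polynomial.C w * (r k).map (algebraMap ℝ ℂ)) = 0 := by
      rw [Polynomial.derivative_sub, Polynomial.derivative_C_mul, Polynomial.derivative_map, hr,
        hq, sub_self]
    exact ⟨_, sub_eq_iff_eq_add'.mp
      (Polynomial.eq_C_of_natDegree_eq_zero (Polynomial.derivative_eq_zero.mp h0))⟩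
  choose c hc using hp
  obtain ⟨q', hq'⟩ := exists_eq_aeval_of_map_eq (g := g) (Q := ∑ k, inVar k (r k))
    (h := h.comp (Polynomial.C w * Polynomial.X + Polynomial.C (∑ k, c k))) (by
      rw [hg, Polynomial.aeval_comp]
      congr 1
      simp only [map_sum, map_add, map_mul, Polynomial.aeval_C, Polynomial.aeval_X, map_inVar]
      rw [Finset.mul_sum, ← Finset.sum_add_distrib]
      refine congrArg _ (Finset.sum_congr rfl fun k _ => ?_)
      rw [hc k]
      simp only [inVar, map_add, map_mul, Polynomial.aeval_C])
  exact ⟨q', r, hq'⟩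

/-- Here p_k ∂_k g = M p_k'. Conjugating and eliminating ∂_k g gives the phase relation for s_k =
p_k' p̄_k. Once the phase is real, p_k and p̄_k have zero Wronskian and are proportional. -/
theorem exists_real_multiplicative {g : MvPolynomial σ ℝ} {h : ℂ[X]} {p : σ → ℂ[X]}
    (hg : map (algebraMap ℝ ℂ) g = Polynomial.aeval (∏ i, inVar i (p i)) h) :
    ∃ (q : ℝ[X]) (r : σ → ℝ[X]), g = Polynomial.aeval (∏ i, inVar i (r i)) q := by
  classical
  rcases eq_C_or_eq_inVar_or_two_pderiv_ne_zero g with ⟨c, rfl⟩ | ⟨i, q, rfl⟩ | ⟨i, j, hij, hi, hj⟩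
  · exact ⟨Polynomial.C c, 0, by rw [Polynomial.aeval_C]; rfl⟩
  · refine ⟨q, Pi.mulSingle i Polynomial.X, ?_⟩
    rw [Finset.prod_eq_single i (fun j _ hj => by simp [Pi.mulSingle_eq_of_ne hj]) (by simp)]
    simp
  set P := ∏ i, inVar i (p i) with hP
  set M := Polynomial.aeval P (Polynomial.derivative h) * P with hM
  have hi' := pderiv_map_ne_zero hi
  have hj' := pderiv_map_ne_zero hj
  have hd : ∀ k, inVar k (p k) * pderiv k (map (algebraMap ℝ ℂ) g) =
      M * inVar k (Polynomial.derivative (p k)) := fun k => by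
    rw [hg, Derivation.map_aeval, hP, pderiv_prod_inVar, smul_eq_mul, hM, hP,
      ← Finset.mul_prod_erase _ _ (Finset.mem_univ k)]
    ring
  have hp0 : ∀ k, p k ≠ 0 := by
    intro k hk
    have hP0 : P = 0 := Finset.prod_eq_zero (Finset.mem_univ k) (by rw [hk, inVar_zero])
    rw [hg, hP0, Derivation.map_aeval, map_zero, smul_zero] at hi'
    exact hi' rfl
  have hd' : ∀ k, inVar k ((p k).map (starRingEnd ℂ)) * pderiv k (map (algebraMap ℝ ℂ) g) =
      map (starRingEnd ℂ) M * inVar k ((Polynomial.derivative (p k)).map (starRingEnd ℂ)) :=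
    fun k => by
      rw [← map_inVar, ← map_inVar, ← map_mul, ← hd, map_mul, ← pderiv_map, map_conj_map]
  have hconj : ∀ q : ℂ[X], (q.map (starRingEnd ℂ)).map (starRingEnd ℂ) = q := fun q => by
    ext n
    simp
  have hp0' : ∀ k, (p k).map (starRingEnd ℂ) ≠ 0 := fun k =>
    (Polynomial.map_ne_zero_iff (starRingEnd ℂ).injective).mpr (hp0 k)
  have hM0 : M ≠ 0 := fun h0 => by
    have := hd i
    rw [h0, zero_mul] at this
    exact mul_ne_zero (inVar_ne_zero i (hp0 i)) hi' this
  have hN0 : map (starRingEnd ℂ) M ≠ 0 := fun h0 => by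
    have := hd' i
    rw [h0, zero_mul] at this
    exact mul_ne_zero (inVar_ne_zero i (hp0' i)) hi' this
  have hdp : ∀ k, pderiv k (map (algebraMap ℝ ℂ) g) ≠ 0 → Polynomial.derivative (p k) ≠ 0 := by
    intro k hk h0
    have := hd k
    rw [h0, inVar_zero, mul_zero] at this
    exact mul_ne_zero (inVar_ne_zero k (hp0 k)) hk this
  obtain ⟨w, hw, hq⟩ := exists_forall_eq_C_mul_map
    (s := fun k => Polynomial.derivative (p k) * (p k).map (starRingEnd ℂ)) hM0 hN0 (fun k => by
      rw [Polynomial.map_mul, hconj, inVar_mul, inVar_mul]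
      linear_combination inVar k (p k) * hd' k - inVar k ((p k).map (starRingEnd ℂ)) * hd k) hij
    (mul_ne_zero (hdp i hi') (hp0' i)) (mul_ne_zero (hdp j hj') (hp0' j))
  choose q hq using hq
  -- The leading coefficient of p_i' p̄_i is deg p_i · |lc p_i|², which is real.
  have hwr : starRingEnd ℂ w = w := by
    have h1 := congrArg Polynomial.leadingCoeff (hq i)
    have hq0 : (q i).leadingCoeff ≠ 0 := fun h0 => by
      rw [Polynomial.leadingCoeff_eq_zero] at h0
      have := hq i
      rw [h0, Polynomial.map_zero, mul_zero] at this
      exact mul_ne_zero (hdp i hi') (hp0' i) this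
    rw [Polynomial.leadingCoeff_mul, Polynomial.leadingCoeff_mul, Polynomial.leadingCoeff_C,
      Polynomial.leadingCoeff_map, Polynomial.leadingCoeff_map,
      Polynomial.leadingCoeff_derivative] at h1
    have hq0' : algebraMap ℝ ℂ (q i).leadingCoeff ≠ 0 := (map_ne_zero _).mpr hq0
    have h2 := congrArg (starRingEnd ℂ) h1
    apply mul_right_cancel₀ hq0'
    rw [← h1]
    simp only [map_mul, Complex.conj_conj, map_natCast, Complex.coe_algebraMap,
      Complex.conj_ofReal] at h2
    rw [Complex.coe_algebraMap, ← h2]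
    ring
  have hz : ∀ k, ∃ (z : ℂ) (r : ℝ[X]), p k = Polynomial.C z * r.map (algebraMap ℝ ℂ) := by
    intro k
    have hwr' : Polynomial.derivative (p k) * (p k).map (starRingEnd ℂ) =
        (Polynomial.derivative (p k)).map (starRingEnd ℂ) * p k := by
      have h1 := congrArg (Polynomial.map (starRingEnd ℂ)) (hq k)
      rw [Polynomial.map_mul, Polynomial.map_mul, hconj, Polynomial.map_C, hwr,
        Polynomial.map_map] at h1
      rw [hq k, h1]
      congr 2
      ext x
      simp
    obtain ⟨c, hc⟩ := exists_eq_C_mul_of_wronskian_eq_zero (u := inVar k (p k))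
      (inVar_ne_zero k (hp0' k)) fun l => by
        by_cases hkl : k = l
        · rw [← hkl, pderiv_inVar_self, pderiv_inVar_self, Polynomial.derivative_map, ← map_mul,
            ← map_mul, mul_comm, hwr', mul_comm]
        · rw [pderiv_inVar_of_ne hkl, pderiv_inVar_of_ne hkl, mul_zero, mul_zero]
    have hc' : p k = Polynomial.C c * (p k).map (starRingEnd ℂ) := by
      apply inVar_injective k
      rw [hc, inVar_mul, inVar_C]
    obtain ⟨t, ht⟩ := Polynomial.exists_real_eval_ne_zero (hp0 k)
    refine ⟨_, Polynomial.exists_eq_C_mul_map ht ?_⟩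
    have h1 := congrArg (Polynomial.eval (t : ℂ)) hc'
    rw [Polynomial.eval_mul, Polynomial.eval_C, Polynomial.eval_map_conj_ofReal] at h1
    have h2 := congrArg Polynomial.C h1
    rw [Polynomial.C_mul] at h2
    linear_combination Polynomial.C (starRingEnd ℂ ((p k).eval (t : ℂ))) * hc' -
      (p k).map (starRingEnd ℂ) * h2
  choose z r hr using hz
  obtain ⟨q', hq'⟩ := exists_eq_aeval_of_map_eq (g := g) (Q := ∏ k, inVar k (r k))
    (h := h.comp (Polynomial.C (∏ k, z k) * Polynomial.X)) (by
      rw [hg, Polynomial.aeval_comp]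
      congr 1
      simp only [map_prod, map_mul, Polynomial.aeval_C, Polynomial.aeval_X, map_inVar]
      rw [hP, ← Finset.prod_mul_distrib]
      refine congrArg _ (Finset.prod_congr rfl fun k _ => ?_)
      rw [hr k]
      simp only [inVar, map_mul, Polynomial.aeval_C])
  exact ⟨q', r, hq'⟩

end Real

/-- Nonzero numerators stay nonzero after substituting a variable, so cross-multiplying in the
fraction field is legitimate. -/
theorem cross_mul_of_div_ratFuncInVar_eq {K : Type*} [Field K] {d : ℕ} {u v : MvPolynomial (Fin d) K}
    {i j : Fin d} {r s : RatFunc K} (hr : r ≠ 0) (hs : s ≠ 0)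
    (h : algebraMap _ (FractionRing (MvPolynomial (Fin d) K)) u / ratFuncInVar i r =
      algebraMap _ (FractionRing (MvPolynomial (Fin d) K)) v / ratFuncInVar j s) :
    u * inVar i r.denom * inVar j s.num = v * inVar j s.denom * inVar i r.num := by
  have heval : ∀ (k : Fin d) (p : K[X]),
      Polynomial.eval₂ (algebraMap K (FractionRing (MvPolynomial (Fin d) K)))
        (algebraMap (MvPolynomial (Fin d) K) (FractionRing (MvPolynomial (Fin d) K)) (X k)) p =
      algebraMap (MvPolynomial (Fin d) K) (FractionRing (MvPolynomial (Fin d) K)) (inVar k p) := by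
    intro k p
    rw [← Polynomial.aeval_def, Polynomial.aeval_algebraMap_apply]
  have hinj := IsFractionRing.injective (MvPolynomial (Fin d) K)
    (FractionRing (MvPolynomial (Fin d) K))
  have hne : ∀ (k : Fin d) (p : K[X]), p ≠ 0 →
      algebraMap (MvPolynomial (Fin d) K) (FractionRing (MvPolynomial (Fin d) K))
        (inVar k p) ≠ 0 := fun k p hp => (map_ne_zero_iff _ hinj).mpr (inVar_ne_zero k hp)
  have h1 := hne i _ (RatFunc.num_ne_zero hr)
  have h2 := hne j _ (RatFunc.num_ne_zero hs)
  rw [ratFuncInVar, ratFuncInVar, RatFunc.eval, RatFunc.eval, heval, heval, heval, heval,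
    div_div_eq_mul_div, div_div_eq_mul_div, div_eq_div_iff h1 h2] at h
  apply hinj
  simpa only [map_mul] using h

end MvPolynomial

open MvPolynomial in
theorem lemma2p3 (d : ℕ) (f : MvPolynomial (Fin d) ℂ) (r : Fin d → RatFunc ℂ)
    (hr : ∀ i, r i ≠ 0)
    (hf : ∀ i j : Fin d,
      algebraMap (MvPolynomial (Fin d) ℂ) (FractionRing (MvPolynomial (Fin d) ℂ))
          (MvPolynomial.pderiv i f) / ratFuncInVar i (r i) =
        algebraMap (MvPolynomial (Fin d) ℂ) (FractionRing (MvPolynomial (Fin d) ℂ))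
          (MvPolynomial.pderiv j f) / ratFuncInVar j (r j)) :
    (HasAdditiveForm f ∨ HasMultiplicativeForm f) ∧
      ∀ g : MvPolynomial (Fin d) ℝ, MvPolynomial.map (algebraMap ℝ ℂ) g = f →
        (HasAdditiveForm f → HasAdditiveForm g) ∧
          (HasMultiplicativeForm f → HasMultiplicativeForm g) := by
  refine ⟨?_, ?_⟩
  -- The last case supplies two distinct indices, as E requires; the others, including d ≤ 1, are
  -- additive by inspection.
  · rcases eq_C_or_eq_inVar_or_two_pderiv_ne_zero f with ⟨c, rfl⟩ | ⟨i, q, rfl⟩ | ⟨i, j, hij, -⟩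
    · exact Or.inl ⟨Polynomial.C c, 0, by rw [Polynomial.aeval_C]; rfl⟩
    · refine Or.inl ⟨q, Pi.single i Polynomial.X, ?_⟩
      rw [Finset.sum_eq_single i (fun j _ hj => by simp [Pi.single_eq_of_ne hj]) (by simp)]
      simp
    have : Nontrivial (Fin d) := ⟨i, j, hij⟩
    have ha : ∀ i, (r i).num ≠ 0 := fun i => RatFunc.num_ne_zero (hr i)
    have hab : ∀ i, IsCoprime (r i).num (r i).denom := fun i => (r i).isCoprime_num_denom
    obtain ⟨g, hg⟩ := EulerRel.exists_of_cross_mul_eq ha hab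
      fun i j => cross_mul_of_div_ratFuncInVar_eq (hr i) (hr j) (hf i j)
    exact hg.exists_form ha (fun i => (r i).denom_ne_zero) hab
  · rintro g rfl
    exact ⟨fun ⟨_, _, h⟩ => exists_real_additive h, fun ⟨_, _, h⟩ => exists_real_multiplicative h⟩
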